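/- Let $\Omega\subset\mathbb{R}^d$ be an open set with an outer unit normal $n(z)$ at almost every $z\in\partial\Omega$ with respect to $(d-1)$-dimensional Hausdorff measure, and let $F$ be a finite-dimensional real inner product space (for instance $F=\mathbb{R}$ or $F=\mathbb{R}^d$). Let $L^2(\Omega)$ be the space of square-integrable functions $\Omega\to F$ with $\langle u,v\rangle_{L^2}=\int_\Omega \langle u(y),v(y)\rangle\,dy$, and let $H^1(\Omega)$ be the space of those $u\in L^2(\Omega)$ whose weak partial derivatives $\partial_1u,\dots,\partial_du$ belong to $L^2(\Omega)$, with $\langle u,v\rangle_{H^1}=\int_\Omega \langle u(y),v(y)\rangle\,dy+\int_\Omega\sum_{i=1}^d\langle\partial_iu(y),\partial_iv(y)\rangle\,dy$. Let $f:H^1(\Omega)\to\mathbb{R}$ and $x\in H^1(\Omega)$ be such that the directional derivative $Df(x;v)=\lim_{\varepsilon\to0}\frac{f(x+\varepsilon v)-f(x)}{\varepsilon}$ exists for every $v\in H^1(\Omega)$. Let $\nabla^{L}f\in L^2(\Omega)$ and $\nabla^{H}f\in H^1(\Omega)$ be the $L^2$ gradient and the $H^1$ (Sobolev) gradient of $f$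 at $x$, that is, $$Df(x;v)=\langle\nabla^{L}f,v\rangle_{L^2}=\langle\nabla^{H}f,v\rangle_{H^1}\qquad\text{for all }v\in H^1(\Omega).$$ Suppose that $\frac{\partial}{\partial n}\nabla^{H}f=0$ almost everywhere on $\partial\Omega$, the boundary values being taken in the trace sense: for almost every $z\in\partial\Omega$, the mean value of $\big|\sum_i n_i(z)\,\partial_i(\nabla^{H}f)\big|$ over $B(z,r)\cap\Omega$ tends to $0$ as $r\to0$. Then the weak Laplacian $\Delta\nabla^{H}f$ exists in $L^2(\Omega)$, and $$(I-\Delta)\nabla^{H}f=\nabla^{L}f\qquad\text{almost everywhere on }\Omega.$$ -/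

import Mathlib

open MeasureTheory Filter Topology
open scoped ContDiff Laplacian

noncomputable section

namespace SobolevSmoothing

variable {d : ℕ} {F : Type*} [NormedAddCommGroup F] [InnerProductSpace ℝ F]

/-- Test functions on `Ω`: smooth real functions whose support is a compact subset of `Ω`. -/
structure IsTestFunction (Ω : Set (EuclideanSpace ℝ (Fin d))) (φ : EuclideanSpace ℝ (Fin d) → ℝ) :
    Prop where
  smooth : ContDiff ℝ ∞ φ
  compact : HasCompactSupport φ
  subset : tsupport φ ⊆ Ω

variable (F) in
/-- The Hilbert space `L²(Ω; F)` of square-integrable functions `Ω → F`, up to equality almost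
everywhere, with inner product `⟪u, v⟫ = ∫_Ω ⟪u(y), v(y)⟫ dy`. -/
abbrev L2 (Ω : Set (EuclideanSpace ℝ (Fin d))) : Type _ :=
  Lp F 2 ((volume : Measure (EuclideanSpace ℝ (Fin d))).restrict Ω)

/-- `w` is the weak partial derivative `∂ᵢ u` on `Ω`. -/
def IsWeakPartial (Ω : Set (EuclideanSpace ℝ (Fin d))) (i : Fin d) (u w : L2 F Ω) : Prop :=
  ∀ φ : EuclideanSpace ℝ (Fin d) → ℝ, IsTestFunction Ω φ →
    ∫ y in Ω, lineDeriv ℝ φ y (EuclideanSpace.single i 1) • u y = -∫ y in Ω, φ y • w y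

/-- `w` is the weak (distributional) Laplacian `Δ u` on `Ω`. -/
def IsWeakLaplacian (Ω : Set (EuclideanSpace ℝ (Fin d))) (u w : L2 F Ω) : Prop :=
  ∀ φ : EuclideanSpace ℝ (Fin d) → ℝ, IsTestFunction Ω φ →
    ∫ y in Ω, Δ φ y • u y = ∫ y in Ω, φ y • w y

lemma IsTestFunction.lineDeriv {Ω : Set (EuclideanSpace ℝ (Fin d))}
    {φ : EuclideanSpace ℝ (Fin d) → ℝ} (h : IsTestFunction Ω φ) (e : EuclideanSpace ℝ (Fin d)) :
    IsTestFunction Ω (fun y => lineDeriv ℝ φ y e) := by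
  have h1 : (fun y => _root_.lineDeriv ℝ φ y e) = fun y => fderiv ℝ φ y e := by
    funext y
    exact (h.smooth.differentiable (by simp) y).lineDeriv_eq_fderiv
  have h2 : tsupport (fun y => fderiv ℝ φ y e) ⊆ tsupport φ :=
    tsupport_fderiv_apply_subset ℝ e
  rw [h1]
  refine ⟨?_, ?_, h2.trans h.subset⟩
  · exact (h.smooth.fderiv_right (m := ∞) (by simp)).clm_apply contDiff_const
  · exact h.compact.of_isClosed_subset (isClosed_tsupport _) h2

lemma IsTestFunction.integrable_smul {Ω : Set (EuclideanSpace ℝ (Fin d))}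
    {φ : EuclideanSpace ℝ (Fin d) → ℝ} (h : IsTestFunction Ω φ) (u : L2 F Ω) :
    Integrable (fun y => φ y • u y) (volume.restrict Ω) := by
  have h1 : MemLp φ 2 ((volume : Measure (EuclideanSpace ℝ (Fin d))).restrict Ω) :=
    (h.smooth.continuous.memLp_of_hasCompactSupport h.compact).restrict Ω
  have h2 := (Lp.memLp u).smul (r := 1) h1
  exact memLp_one_iff_integrable.1 h2

lemma IsWeakPartial.zero (Ω : Set (EuclideanSpace ℝ (Fin d))) (i : Fin d) :
    IsWeakPartial Ω i (0 : L2 F Ω) 0 := by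
  intro φ _
  have h0 := Lp.coeFn_zero F 2 ((volume : Measure (EuclideanSpace ℝ (Fin d))).restrict Ω)
  rw [integral_eq_zero_of_ae, integral_eq_zero_of_ae, neg_zero]
  · filter_upwards [h0] with y hy
    rw [hy]; simp
  · filter_upwards [h0] with y hy
    rw [hy]; simp

lemma IsWeakPartial.add {Ω : Set (EuclideanSpace ℝ (Fin d))} {i : Fin d} {u u' w w' : L2 F Ω}
    (h : IsWeakPartial Ω i u w) (h' : IsWeakPartial Ω i u' w') :
    IsWeakPartial Ω i (u + u') (w + w') := by
  have key : ∀ (ψ : EuclideanSpace ℝ (Fin d) → ℝ), IsTestFunction Ω ψ → ∀ a b : L2 F Ω,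
      ∫ y in Ω, ψ y • (a + b : L2 F Ω) y = (∫ y in Ω, ψ y • a y) + ∫ y in Ω, ψ y • b y := by
    intro ψ hψ a b
    rw [← integral_add (hψ.integrable_smul a) (hψ.integrable_smul b)]
    refine integral_congr_ae ?_
    filter_upwards [Lp.coeFn_add a b] with y hy
    rw [hy, Pi.add_apply, smul_add]
  intro φ hφ
  rw [key _ (hφ.lineDeriv _), key _ hφ, h φ hφ, h' φ hφ, neg_add]

lemma IsWeakPartial.smul {Ω : Set (EuclideanSpace ℝ (Fin d))} {i : Fin d} {u w : L2 F Ω}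
    (c : ℝ) (h : IsWeakPartial Ω i u w) : IsWeakPartial Ω i (c • u) (c • w) := by
  have key : ∀ (ψ : EuclideanSpace ℝ (Fin d) → ℝ), ∀ a : L2 F Ω,
      ∫ y in Ω, ψ y • (c • a : L2 F Ω) y = c • ∫ y in Ω, ψ y • a y := by
    intro ψ a
    rw [← integral_smul]
    refine integral_congr_ae ?_
    filter_upwards [Lp.coeFn_smul c a] with y hy
    rw [hy, Pi.smul_apply, smul_comm]
  intro φ hφ
  rw [key, key, h φ hφ, smul_neg]

variable (F) in
/-- The Sobolev space `H¹(Ω; F)`: the functions in `L²(Ω; F)` all of whose weak partial derivatives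
exist in `L²(Ω; F)`. -/
def H1 (Ω : Set (EuclideanSpace ℝ (Fin d))) : Submodule ℝ (L2 F Ω) where
  carrier := {u | ∀ i, ∃ w : L2 F Ω, IsWeakPartial Ω i u w}
  zero_mem' i := ⟨0, IsWeakPartial.zero Ω i⟩
  add_mem' hu hv i := by
    obtain ⟨w, hw⟩ := hu i
    obtain ⟨w', hw'⟩ := hv i
    exact ⟨w + w', hw.add hw'⟩
  smul_mem' c _ hu i := by
    obtain ⟨w, hw⟩ := hu i
    exact ⟨c • w, hw.smul c⟩

/-- The weak partial derivative `∂ᵢ u` of `u ∈ H¹(Ω; F)`; it is unique when `Ω` is open. -/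
def weakPartial {Ω : Set (EuclideanSpace ℝ (Fin d))} (i : Fin d) (u : H1 F Ω) : L2 F Ω :=
  (u.2 i).choose

lemma isWeakPartial_weakPartial {Ω : Set (EuclideanSpace ℝ (Fin d))} (i : Fin d) (u : H1 F Ω) :
    IsWeakPartial Ω i (u : L2 F Ω) (weakPartial i u) :=
  (u.2 i).choose_spec

/-- The inner product of `H¹(Ω; F)`: `∫_Ω ⟪u, v⟫ + ∫_Ω ⟪∇u, ∇v⟫`. -/
def h1Inner {Ω : Set (EuclideanSpace ℝ (Fin d))} (u v : H1 F Ω) : ℝ :=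
  (∫ y in Ω, inner ℝ ((u : L2 F Ω) y) ((v : L2 F Ω) y)) +
    ∫ y in Ω, ∑ i, inner ℝ (weakPartial i u y) (weakPartial i v y)

/-- `g ∈ L²(Ω; F)` is the `L²` gradient at `x` of the functional `f` on `H¹(Ω; F)`: it represents
the directional derivative `v ↦ Df(x; v)` through the `L²` inner product. -/
def IsL2Gradient {Ω : Set (EuclideanSpace ℝ (Fin d))} (f : H1 F Ω → ℝ) (x : H1 F Ω) (g : L2 F Ω) :
    Prop :=
  ∀ v : H1 F Ω, HasLineDerivAt ℝ f (∫ y in Ω, inner ℝ (g y) ((v : L2 F Ω) y)) x v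

/-- `g ∈ H¹(Ω; F)` is the `H¹` (Sobolev) gradient at `x` of the functional `f` on `H¹(Ω; F)`: it
represents the directional derivative `v ↦ Df(x; v)` through the `H¹` inner product. -/
def IsH1Gradient {Ω : Set (EuclideanSpace ℝ (Fin d))} (f : H1 F Ω → ℝ) (x g : H1 F Ω) : Prop :=
  ∀ v : H1 F Ω, HasLineDerivAt ℝ f (h1Inner g v) x v

/-- `ν` is the outer unit normal of `Ω` at the boundary point `x`: near `x`, up to an arbitrarily
thin cone around the hyperplane through `x` orthogonal to `ν`, the points on the side of `-ν` are in
`Ω` and those on the side of `ν` are not. -/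
def IsOuterUnitNormal (Ω : Set (EuclideanSpace ℝ (Fin d))) (x ν : EuclideanSpace ℝ (Fin d)) :
    Prop :=
  x ∈ frontier Ω ∧ ‖ν‖ = 1 ∧ ∀ ε > (0 : ℝ), ∀ᶠ y in 𝓝 x,
    (inner ℝ (y - x) ν < -(ε * ‖y - x‖) → y ∈ Ω) ∧ (ε * ‖y - x‖ < inner ℝ (y - x) ν → y ∉ Ω)

/-- The function `u` on `Ω` has the boundary value (trace) `a` at the boundary point `x`, in the
sense of Lebesgue: the mean of `‖u - a‖` over `B(x, r) ∩ Ω` tends to zero with `r`. On a Lipschitz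
domain the trace of a Sobolev function has this property at almost every boundary point. -/
def HasTraceAt (Ω : Set (EuclideanSpace ℝ (Fin d))) (u : EuclideanSpace ℝ (Fin d) → F) (a : F)
    (x : EuclideanSpace ℝ (Fin d)) : Prop :=
  Tendsto (fun r : ℝ => ⨍ y in Metric.ball x r ∩ Ω, ‖u y - a‖) (𝓝[>] 0) (𝓝 0)

/-- `u ∈ H¹(Ω; F)` has the normal derivative `∂u/∂ν = a` at the boundary point `x`, where `ν` is the
outer unit normal there: `∑ᵢ νᵢ ∂ᵢu` has the trace `a` at `x`. -/
def HasNormalDerivAt {Ω : Set (EuclideanSpace ℝ (Fin d))} (u : H1 F Ω) (a : F)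
    (x ν : EuclideanSpace ℝ (Fin d)) : Prop :=
  HasTraceAt Ω (fun y => ∑ i, ν i • weakPartial i u y) a x

/-- Surface measure on the boundary of `Ω`: `(d-1)`-dimensional Hausdorff measure. -/
def surfaceMeasure (Ω : Set (EuclideanSpace ℝ (Fin d))) : Measure (EuclideanSpace ℝ (Fin d)) :=
  (Measure.hausdorffMeasure ((d : ℝ) - 1)).restrict (frontier Ω)

end SobolevSmoothing

end

/-! The two gradients represent the same directional derivative, so `⟪∇ᴴf, v⟫_{H¹} = ⟪∇ᴸf, v⟫_{L²}`
along every `v = φ e`, where `φ` is a test function on `Ω` and `e ∈ F` is a constant vector. Moving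
the derivatives from `∇ᴴf` to `φ` by the definition of the weak partial derivatives leaves no
boundary term, as `φ` has compact support in `Ω`, and turns this into
`⟪∫ φ ∇ᴴf - ∫ Δφ ∇ᴴf, e⟫ = ⟪∫ φ ∇ᴸf, e⟫`. Since `e` is arbitrary, `∇ᴴf - ∇ᴸf` is the weak Laplacian
of `∇ᴴf`. -/

noncomputable section

namespace SobolevSmoothing

lemma laplacian_eq_sum_lineDeriv_lineDeriv {ι E G : Type*} [Fintype ι] [NormedAddCommGroup E]
    [InnerProductSpace ℝ E] [FiniteDimensional ℝ E] [NormedAddCommGroup G] [NormedSpace ℝ G]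
    (b : OrthonormalBasis ι ℝ E) {f : E → G} (hf : ContDiff ℝ 2 f) (y : E) :
    Δ f y = ∑ i, lineDeriv ℝ (fun z => lineDeriv ℝ f z (b i)) y (b i) := by
  have hf' : Differentiable ℝ (fderiv ℝ f) :=
    (hf.fderiv_right (m := 1) (by norm_num)).differentiable one_ne_zero
  have hlineDeriv (e : E) : (fun z => lineDeriv ℝ f z e) = fun z => fderiv ℝ f z e :=
    funext fun z => (hf.differentiable two_ne_zero z).lineDeriv_eq_fderiv
  rw [InnerProductSpace.laplacian_eq_iteratedFDeriv_orthonormalBasis f b]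
  refine Finset.sum_congr rfl fun i _ => ?_
  rw [hlineDeriv, ((hf' y).clm_apply (differentiableAt_const _)).lineDeriv_eq_fderiv,
    iteratedFDeriv_two_apply, fderiv_clm_apply (hf' y) (differentiableAt_const _)]
  simp

variable {d : ℕ} {F : Type*} [NormedAddCommGroup F] [InnerProductSpace ℝ F]
  {Ω : Set (EuclideanSpace ℝ (Fin d))} {φ : EuclideanSpace ℝ (Fin d) → ℝ}
  {u u' : EuclideanSpace ℝ (Fin d) → F} {i : Fin d}

lemma IsTestFunction.hasLineDerivAt (hφ : IsTestFunction Ω φ) (y e : EuclideanSpace ℝ (Fin d)) :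
    HasLineDerivAt ℝ φ (_root_.lineDeriv ℝ φ y e) y e :=
  (hφ.smooth.differentiable (by simp) y).lineDifferentiableAt.hasLineDerivAt

lemma IsTestFunction.eq_zero_of_notMem (hφ : IsTestFunction Ω φ) {y : EuclideanSpace ℝ (Fin d)}
    (hy : y ∉ Ω) : φ y = 0 :=
  image_eq_zero_of_notMem_tsupport fun hy' => hy (hφ.subset hy')

lemma IsTestFunction.setIntegral_smul (hφ : IsTestFunction Ω φ)
    (u : EuclideanSpace ℝ (Fin d) → F) : ∫ y in Ω, φ y • u y = ∫ y, φ y • u y :=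
  setIntegral_eq_integral_of_forall_compl_eq_zero fun y hy => by
    rw [hφ.eq_zero_of_notMem hy, zero_smul]

lemma IsTestFunction.setIntegral_smul_toLp (hφ : IsTestFunction Ω φ)
    (hu : MemLp u 2 (volume.restrict Ω)) :
    ∫ y in Ω, φ y • hu.toLp u y = ∫ y, φ y • u y := by
  rw [← hφ.setIntegral_smul u]
  refine integral_congr_ae ?_
  filter_upwards [hu.coeFn_toLp] with y hy
  rw [hy]

lemma IsTestFunction.integrable_smul_of_memLp (hφ : IsTestFunction Ω φ)
    (hu : MemLp u 2 (volume.restrict Ω)) : Integrable fun y => φ y • u y := by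
  have hsupport : Function.support (fun y => φ y • u y) ⊆ Ω := fun y hy =>
    by_contra fun hyΩ => hy (by simp only [hφ.eq_zero_of_notMem hyΩ, zero_smul])
  rw [← integrableOn_iff_integrable_of_support_subset hsupport]
  refine (hφ.integrable_smul (hu.toLp u)).congr ?_
  filter_upwards [hu.coeFn_toLp] with y hy
  rw [hy]

lemma isWeakPartial_toLp (hu : MemLp u 2 (volume.restrict Ω)) (hu' : MemLp u' 2 (volume.restrict Ω))
    (hderiv : ∀ y ∈ Ω, HasLineDerivAt ℝ u (u' y) y (EuclideanSpace.single i 1)) :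
    IsWeakPartial Ω i (hu.toLp u) (hu'.toLp u') := by
  intro φ hφ
  have hparts := integral_bilinear_hasLineDerivAt_right_eq_neg_left_of_integrable
    (B := ContinuousLinearMap.lsmul ℝ ℝ) ((hφ.lineDeriv _).integrable_smul_of_memLp hu)
    (hφ.integrable_smul_of_memLp hu') (hφ.integrable_smul_of_memLp hu)
    (fun y _ => hφ.hasLineDerivAt y _) fun y hy => hderiv y (hφ.subset hy)
  rw [(hφ.lineDeriv _).setIntegral_smul_toLp, hφ.setIntegral_smul_toLp]
  exact (neg_eq_iff_eq_neg.2 hparts).symm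

lemma IsWeakPartial.unique [CompleteSpace F] (hΩ : IsOpen Ω) {v w w' : L2 F Ω}
    (hw : IsWeakPartial Ω i v w) (hw' : IsWeakPartial Ω i v w') : w = w' := by
  have hloc (a : L2 F Ω) : LocallyIntegrableOn a Ω volume :=
    locallyIntegrableOn_of_locallyIntegrable_restrict
      ((Lp.memLp a).locallyIntegrable (by norm_num))
  have hzero := hΩ.ae_eq_zero_of_integral_contDiff_smul_eq_zero ((hloc w).sub (hloc w'))
    fun φ hsmooth hcompact hsubset => by
      have hφ : IsTestFunction Ω φ := ⟨hsmooth, hcompact, hsubset⟩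
      rw [← hφ.setIntegral_smul]
      simp_rw [Pi.sub_apply, smul_sub]
      rw [integral_sub (hφ.integrable_smul w) (hφ.integrable_smul w'), sub_eq_zero]
      exact neg_injective ((hw φ hφ).symm.trans (hw' φ hφ))
  refine Lp.ext ?_
  filter_upwards [(ae_restrict_iff' hΩ.measurableSet).2 hzero] with y hy
  exact sub_eq_zero.1 hy

lemma IsTestFunction.setIntegral_laplacian_smul (hφ : IsTestFunction Ω φ) {v : L2 F Ω}
    {w : Fin d → L2 F Ω} (hw : ∀ i, IsWeakPartial Ω i v (w i)) :
    ∫ y in Ω, Δ φ y • v y =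
      -∑ i, ∫ y in Ω, _root_.lineDeriv ℝ φ y (EuclideanSpace.single i 1) • w i y := by
  have hΔ (y : EuclideanSpace ℝ (Fin d)) : Δ φ y = ∑ i, _root_.lineDeriv ℝ
      (fun z => _root_.lineDeriv ℝ φ z (EuclideanSpace.single i 1)) y
        (EuclideanSpace.single i 1) := by
    simpa only [EuclideanSpace.basisFun_apply] using laplacian_eq_sum_lineDeriv_lineDeriv
      (EuclideanSpace.basisFun (Fin d) ℝ) (hφ.smooth.of_le (by norm_cast)) y
  simp_rw [hΔ, Finset.sum_smul]
  rw [integral_finsetSum _ fun i _ => ((hφ.lineDeriv _).lineDeriv _).integrable_smul v,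
    ← Finset.sum_neg_distrib]
  exact Finset.sum_congr rfl fun i _ => hw i _ (hφ.lineDeriv _)

lemma IsTestFunction.memLp_smul_const (hφ : IsTestFunction Ω φ) (e : F) :
    MemLp (fun y => φ y • e) 2 (volume.restrict Ω) :=
  ((hφ.smooth.continuous.smul continuous_const).memLp_of_hasCompactSupport
    hφ.compact.smul_right).restrict Ω

lemma IsTestFunction.isWeakPartial_smul_const (hφ : IsTestFunction Ω φ) (e : F) (i : Fin d) :
    IsWeakPartial Ω i ((hφ.memLp_smul_const e).toLp _)
      (((hφ.lineDeriv (EuclideanSpace.single i 1)).memLp_smul_const e).toLp _) :=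
  isWeakPartial_toLp (hφ.memLp_smul_const e) ((hφ.lineDeriv _).memLp_smul_const e) fun y _ =>
    HasDerivAt.smul_const (hφ.hasLineDerivAt y _) e

/-- The vector-valued test function `φ e`, as an element of `H¹(Ω; F)`: a direction of
differentiation along which integration by parts has no boundary term. -/
def IsTestFunction.toH1 (hφ : IsTestFunction Ω φ) (e : F) : H1 F Ω :=
  ⟨(hφ.memLp_smul_const e).toLp _, fun i => ⟨_, hφ.isWeakPartial_smul_const e i⟩⟩

lemma IsTestFunction.coeFn_toH1 (hφ : IsTestFunction Ω φ) (e : F) :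
    (hφ.toH1 e : L2 F Ω) =ᵐ[volume.restrict Ω] fun y => φ y • e :=
  (hφ.memLp_smul_const e).coeFn_toLp

lemma IsTestFunction.coeFn_weakPartial_toH1 [CompleteSpace F] (hΩ : IsOpen Ω)
    (hφ : IsTestFunction Ω φ) (e : F) (i : Fin d) :
    weakPartial i (hφ.toH1 e) =ᵐ[volume.restrict Ω]
      fun y => _root_.lineDeriv ℝ φ y (EuclideanSpace.single i 1) • e := by
  rw [(isWeakPartial_weakPartial i (hφ.toH1 e)).unique hΩ (hφ.isWeakPartial_smul_const e i)]
  exact ((hφ.lineDeriv _).memLp_smul_const e).coeFn_toLp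

lemma IsTestFunction.integrable_inner_smul_const (hφ : IsTestFunction Ω φ) (v : L2 F Ω) (e : F) :
    Integrable (fun y => inner ℝ (v y) (φ y • e)) (volume.restrict Ω) := by
  simpa only [real_inner_smul_left, real_inner_smul_right] using
    (hφ.integrable_smul v).inner_const (𝕜 := ℝ) e

lemma IsTestFunction.integral_inner_smul_const [CompleteSpace F] (hφ : IsTestFunction Ω φ)
    (v : L2 F Ω) (e : F) :
    ∫ y in Ω, inner ℝ (v y) (φ y • e) = inner ℝ (∫ y in Ω, φ y • v y) e := by
  rw [real_inner_comm, ← integral_inner (hφ.integrable_smul v)]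
  simp_rw [real_inner_smul_right, real_inner_comm e]

lemma IsTestFunction.integral_inner_toH1 [CompleteSpace F] (hφ : IsTestFunction Ω φ)
    (v : L2 F Ω) (e : F) :
    ∫ y in Ω, inner ℝ (v y) ((hφ.toH1 e : L2 F Ω) y) = inner ℝ (∫ y in Ω, φ y • v y) e := by
  rw [← hφ.integral_inner_smul_const]
  refine integral_congr_ae ?_
  filter_upwards [hφ.coeFn_toH1 e] with y hy
  rw [hy]

lemma IsTestFunction.integral_sum_inner_weakPartial_toH1 [CompleteSpace F] (hΩ : IsOpen Ω)
    (hφ : IsTestFunction Ω φ) (v : H1 F Ω) (e : F) :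
    ∫ y in Ω, ∑ i, inner ℝ (weakPartial i v y) (weakPartial i (hφ.toH1 e) y) =
      -inner ℝ (∫ y in Ω, Δ φ y • (v : L2 F Ω) y) e := by
  let φ' (i : Fin d) (y : EuclideanSpace ℝ (Fin d)) : ℝ :=
    _root_.lineDeriv ℝ φ y (EuclideanSpace.single i 1)
  have hφ' (i : Fin d) : IsTestFunction Ω (φ' i) := hφ.lineDeriv _
  calc ∫ y in Ω, ∑ i, inner ℝ (weakPartial i v y) (weakPartial i (hφ.toH1 e) y)
    _ = ∫ y in Ω, ∑ i, inner ℝ (weakPartial i v y) (φ' i y • e) := by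
        refine integral_congr_ae ?_
        filter_upwards [ae_all_iff.2 (hφ.coeFn_weakPartial_toH1 hΩ e)] with y hy
        simp only [hy, φ']
    _ = ∑ i, inner ℝ (∫ y in Ω, φ' i y • weakPartial i v y) e := by
        rw [integral_finsetSum _ fun i _ => (hφ' i).integrable_inner_smul_const _ e]
        exact Finset.sum_congr rfl fun i _ => (hφ' i).integral_inner_smul_const _ e
    _ = -inner ℝ (∫ y in Ω, Δ φ y • (v : L2 F Ω) y) e := by
        rw [hφ.setIntegral_laplacian_smul fun i => isWeakPartial_weakPartial i v, inner_neg_left,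
          neg_neg, sum_inner]

lemma IsTestFunction.h1Inner_toH1 [CompleteSpace F] (hΩ : IsOpen Ω) (hφ : IsTestFunction Ω φ)
    (v : H1 F Ω) (e : F) :
    h1Inner v (hφ.toH1 e) =
      inner ℝ ((∫ y in Ω, φ y • (v : L2 F Ω) y) - ∫ y in Ω, Δ φ y • (v : L2 F Ω) y) e := by
  rw [h1Inner, hφ.integral_inner_toH1, hφ.integral_sum_inner_weakPartial_toH1 hΩ, inner_sub_left,
    sub_eq_add_neg]

lemma IsTestFunction.setIntegral_smul_sub (hφ : IsTestFunction Ω φ) (v w : L2 F Ω) :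
    ∫ y in Ω, φ y • (v - w : L2 F Ω) y = (∫ y in Ω, φ y • v y) - ∫ y in Ω, φ y • w y := by
  rw [← integral_sub (hφ.integrable_smul v) (hφ.integrable_smul w)]
  refine integral_congr_ae ?_
  filter_upwards [Lp.coeFn_sub v w] with y hy
  rw [hy, Pi.sub_apply, smul_sub]

lemma isWeakLaplacian_sub_iff_h1Inner_toH1_eq [CompleteSpace F] (hΩ : IsOpen Ω) {v : H1 F Ω}
    {g : L2 F Ω} :
    IsWeakLaplacian Ω (v : L2 F Ω) (v - g) ↔
      ∀ φ (hφ : IsTestFunction Ω φ) (e : F),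
        h1Inner v (hφ.toH1 e) = ∫ y in Ω, inner ℝ (g y) ((hφ.toH1 e : L2 F Ω) y) := by
  refine forall₂_congr fun φ hφ => ?_
  simp_rw [hφ.h1Inner_toH1 hΩ, hφ.integral_inner_toH1, hφ.setIntegral_smul_sub]
  rw [← ext_iff_inner_right ℝ, sub_eq_iff_eq_add, eq_sub_iff_add_eq, eq_comm, add_comm]

end SobolevSmoothing

end

open SobolevSmoothing in
theorem theorem3_general {d : ℕ} {F : Type*} [NormedAddCommGroup F] [InnerProductSpace ℝ F]
    [CompleteSpace F] {Ω : Set (EuclideanSpace ℝ (Fin d))} (hΩ : IsOpen Ω) {f : H1 F Ω → ℝ}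
    {x : H1 F Ω} {gradL : L2 F Ω} {gradH : H1 F Ω}
    (hL : ∀ φ (hφ : IsTestFunction Ω φ) (e : F), HasLineDerivAt ℝ f
      (∫ y in Ω, inner ℝ (gradL y) ((hφ.toH1 e : L2 F Ω) y)) x (hφ.toH1 e))
    (hH : ∀ φ (hφ : IsTestFunction Ω φ) (e : F), HasLineDerivAt ℝ f
      (h1Inner gradH (hφ.toH1 e)) x (hφ.toH1 e)) :
    ∃ lapH : L2 F Ω, IsWeakLaplacian Ω (gradH : L2 F Ω) lapH ∧
      ∀ᵐ y ∂(volume.restrict Ω), (gradH : L2 F Ω) y - lapH y = gradL y := by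
  refine ⟨gradH - gradL, (isWeakLaplacian_sub_iff_h1Inner_toH1_eq hΩ).2 fun φ hφ e =>
    (hH φ hφ e).unique (hL φ hφ e), ?_⟩
  filter_upwards [Lp.coeFn_sub (gradH : L2 F Ω) gradL] with y hy
  rw [hy, Pi.sub_apply, sub_sub_cancel]

theorem theorem3 {d : ℕ} {F : Type*} [NormedAddCommGroup F] [InnerProductSpace ℝ F]
    [FiniteDimensional ℝ F]
    (Ω : Set (EuclideanSpace ℝ (Fin d))) (hΩ : IsOpen Ω)
    (n : EuclideanSpace ℝ (Fin d) → EuclideanSpace ℝ (Fin d))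
    (hn : ∀ᵐ z ∂(SobolevSmoothing.surfaceMeasure Ω),
      SobolevSmoothing.IsOuterUnitNormal Ω z (n z))
    (f : SobolevSmoothing.H1 F Ω → ℝ) (x : SobolevSmoothing.H1 F Ω)
    (gradL : SobolevSmoothing.L2 F Ω) (hL : SobolevSmoothing.IsL2Gradient f x gradL)
    (gradH : SobolevSmoothing.H1 F Ω) (hH : SobolevSmoothing.IsH1Gradient f x gradH)
    (hNeumann : ∀ᵐ z ∂(SobolevSmoothing.surfaceMeasure Ω),
      SobolevSmoothing.HasNormalDerivAt gradH 0 z (n z)) :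
    ∃ lapH : SobolevSmoothing.L2 F Ω,
      SobolevSmoothing.IsWeakLaplacian Ω (gradH : SobolevSmoothing.L2 F Ω) lapH ∧
      ∀ᵐ y ∂(volume.restrict Ω), (gradH : SobolevSmoothing.L2 F Ω) y - lapH y = gradL y :=
  theorem3_general hΩ (fun _ hφ e => hL (hφ.toH1 e)) fun _ hφ e => hH (hφ.toH1 e)
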